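/- Let $K/F$ be a cyclic Galois extension of number fields of degree $n$, let $\sigma$ be a generator of $\mathrm{Gal}(K/F)$, and let $u\in\mathcal O_F$. Let $(K/F,\sigma,u)=K\oplus Kz\oplus\cdots\oplus Kz^{n-1}$ be the cyclic algebra with multiplication determined by $zk=\sigma(k)z$ for $k\in K$ and $z^n=u$, and let $$\Lambda=\mathcal O_K\oplus\mathcal O_Kz\oplus\cdots\oplus\mathcal O_Kz^{n-1}$$ be its natural order. For an ideal $I$ of $\mathcal O_F$ write $I\Lambda$ for the two-sided ideal of $\Lambda$ generated by $I$. Let $\mathfrak q$ be a nonzero prime ideal of $\mathcal O_F$ that is inert in $K$ (that is, $\mathfrak q\mathcal O_K$ is a prime ideal of $\mathcal O_K$), suppose that $u\notin\mathfrak q$, and let $s>1$ be an integer. Then: 1. $\Lambda/\mathfrak q^s\Lambda\cong M_n(\mathcal O_F/\mathfrak q^s)$ as $\mathcal O_F$-algebras. 2. The proper two-sided ideals of $\Lambda$ that contain $\mathfrak q^s\Lambda$ are exactly the ideals $\mathfrak q^t\Lambda$ with $1\le t\le s$. 3. For every $1\le t\le s$ one has $\mathfrak q^t\Lambda=\bigoplus_{j=0}^{n-1}\mathfrak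 q^t\mathcal O_K z^j$, and $\Lambda/\mathfrak q^t\Lambda\cong M_n(\mathcal O_F/\mathfrak q^t)$ as $\mathcal O_F$-algebras. -/

import Mathlib

open scoped NumberField

/-- The underlying set of the cyclic algebra `(K/F, σ, u)`, where `K/F` has degree `n`: the
element `x₀ + x₁ z + ⋯ + x_{n-1} z^{n-1}` with `x_i ∈ K` is stored as its tuple of coordinates.
(The multiplication, which depends on `σ` and `u`, is defined below.) -/
@[ext]
structure CyclicAlgebra {F K : Type*} [Field F] [Field K] [Algebra F K]
    (σ : K ≃ₐ[F] K) (u : F) where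
  /-- the coordinates in the left `K`-basis `1, z, …, z^{n-1}` -/
  coeff : Fin (Module.finrank F K) → K

namespace CyclicAlgebra

variable {F K : Type*} [Field F] [Field K] [Algebra F K] {σ : K ≃ₐ[F] K} {u : F}

instance : Zero (CyclicAlgebra σ u) := ⟨⟨fun _ => 0⟩⟩
instance : Add (CyclicAlgebra σ u) := ⟨fun x y => ⟨fun k => x.coeff k + y.coeff k⟩⟩
instance : Neg (CyclicAlgebra σ u) := ⟨fun x => ⟨fun k => -x.coeff k⟩⟩

/-- The identity is `1 · z⁰`. -/
instance : One (CyclicAlgebra σ u) := ⟨⟨fun k => if k.val = 0 then 1 else 0⟩⟩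

/-- The multiplication given by `z a = σ(a) z` and `z^n = u`, that is
`(a z^i) (b z^j) = a σ^i(b) z^{i+j}`, where `z^{i+j} = u z^{i+j-n}` if `i + j ≥ n`.
The coefficient at `z^k` collects for each `i` the term with `j ≡ k - i` modulo `n`
(subtraction in `Fin n` is modulo `n`); `i + j = k` if `i ≤ k`, and `i + j = k + n` otherwise. -/
noncomputable instance : Mul (CyclicAlgebra σ u) :=
  ⟨fun x y => ⟨fun k => ∑ i, (if i ≤ k then 1 else algebraMap F K u) *
    (x.coeff i * (σ ^ i.val) (y.coeff (k - i)))⟩⟩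

@[simp] theorem coeff_zero (k) : (0 : CyclicAlgebra σ u).coeff k = 0 := rfl
@[simp] theorem coeff_add (x y : CyclicAlgebra σ u) (k) :
    (x + y).coeff k = x.coeff k + y.coeff k := rfl
@[simp] theorem coeff_neg (x : CyclicAlgebra σ u) (k) : (-x).coeff k = -x.coeff k := rfl
theorem coeff_one (k) :
    (1 : CyclicAlgebra σ u).coeff k = if k.val = 0 then 1 else 0 := rfl
theorem coeff_mul (x y : CyclicAlgebra σ u) (k) :
    (x * y).coeff k = ∑ i, (if i ≤ k then 1 else algebraMap F K u) *
      (x.coeff i * (σ ^ i.val) (y.coeff (k - i))) := rfl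

instance : AddCommGroup (CyclicAlgebra σ u) where
  add_assoc x y w := by ext k; simp [add_assoc]
  zero_add x := by ext k; simp
  add_zero x := by ext k; simp
  add_comm x y := by ext k; simp [add_comm]
  neg_add_cancel x := by ext k; simp
  nsmul := nsmulRec
  zsmul := zsmulRec

theorem pow_val_add_val_sub [FiniteDimensional F K] [IsGalois F K] (σ : K ≃ₐ[F] K)
    (i j : Fin (Module.finrank F K)) : σ ^ i.val * σ ^ (j - i).val = σ ^ j.val := by
  have h : σ ^ Module.finrank F K = 1 := by
    rw [← IsGalois.card_aut_eq_finrank F K]; exact pow_card_eq_one'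
  rw [← pow_add, Fin.sub_def]
  have hi := i.isLt
  have hj := j.isLt
  by_cases hij : i.val ≤ j.val
  · congr 1
    have : Module.finrank F K - i.val + j.val = Module.finrank F K + (j.val - i.val) := by omega
    simp only [this, Nat.add_mod_left]
    rw [Nat.mod_eq_of_lt (by omega)]; omega
  · have : (Module.finrank F K - i.val + j.val) % Module.finrank F K
        = Module.finrank F K - i.val + j.val := Nat.mod_eq_of_lt (by omega)
    simp only [this]
    have h2 : i.val + (Module.finrank F K - i.val + j.val) = Module.finrank F K + j.val := by omega
    rw [h2, pow_add, h, one_mul]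

/-- The carry factors form a 2-cocycle. -/
theorem carry_mul_carry (n : ℕ) (a : K) (i j k : Fin n) :
    (if j ≤ k then 1 else a) * (if i ≤ j then 1 else a) =
      (if i ≤ k then 1 else a) * (if j - i ≤ k - i then 1 else a) := by
  have key : ∀ p q : Fin n, (p - q).val = if q.val ≤ p.val then p.val - q.val else n - q.val + p.val := by
    intro p q
    rw [Fin.sub_def]
    have hp := p.isLt
    have hq := q.isLt
    split_ifs with h
    · have : n - q.val + p.val = n + (p.val - q.val) := by omega
      simp only [this, Nat.add_mod_left]
      exact Nat.mod_eq_of_lt (by omega)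
    · exact Nat.mod_eq_of_lt (by omega)
  have hi := i.isLt
  have hj := j.isLt
  have hk := k.isLt
  simp only [Fin.le_def, key]
  split_ifs <;> first | (exfalso; omega) | ring

variable [FiniteDimensional F K] [IsGalois F K]

noncomputable instance : Ring (CyclicAlgebra σ u) where
  __ := (inferInstance : AddCommGroup (CyclicAlgebra σ u))
  left_distrib x y w := by
    ext k; simp only [coeff_add, coeff_mul, map_add, mul_add, Finset.sum_add_distrib]
  right_distrib x y w := by
    ext k; simp only [coeff_add, coeff_mul, add_mul, mul_add, Finset.sum_add_distrib]
  zero_mul x := by ext k; simp [coeff_mul]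
  mul_zero x := by ext k; simp [coeff_mul]
  one_mul x := by
    ext k
    have : NeZero (Module.finrank F K) := ⟨Module.finrank_pos.ne'⟩
    rw [coeff_mul, Finset.sum_eq_single 0]
    · simp [coeff_one]
    · intro i _ hi
      have : i.val ≠ 0 := fun h => hi (Fin.ext (by simpa using h))
      simp [coeff_one, this]
    · simp
  mul_one x := by
    ext k
    have : NeZero (Module.finrank F K) := ⟨Module.finrank_pos.ne'⟩
    rw [coeff_mul, Finset.sum_eq_single k]
    · simp [coeff_one]
    · intro i _ hi
      have : (k - i).val ≠ 0 := fun h =>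
        hi (sub_eq_zero.mp (Fin.ext (by simpa using h) : k - i = 0)).symm
      simp [coeff_one, this]
    · simp
  mul_assoc x y w := by
    ext k
    have : NeZero (Module.finrank F K) := ⟨Module.finrank_pos.ne'⟩
    simp only [coeff_mul, map_sum, Finset.mul_sum, Finset.sum_mul]
    rw [Finset.sum_comm]
    refine Finset.sum_congr rfl fun i _ => ?_
    conv_rhs => rw [← Equiv.sum_comp (Equiv.subRight i)]
    refine Finset.sum_congr rfl fun j _ => ?_
    have h1 := carry_mul_carry _ (algebraMap F K u) i j k
    have h2 : (σ ^ i.val) (if j - i ≤ k - i then 1 else algebraMap F K u)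
        = if j - i ≤ k - i then 1 else algebraMap F K u := by
      split_ifs <;> simp
    have h3 : (σ ^ i.val) ((σ ^ (j - i).val) (w.coeff (k - j))) =
        (σ ^ j.val) (w.coeff (k - j)) := by
      rw [← AlgEquiv.mul_apply, pow_val_add_val_sub]
    simp only [Equiv.subRight_apply, map_mul, h2, h3, sub_sub_sub_cancel_right]
    linear_combination (x.coeff i * (σ ^ i.val) (y.coeff (j - i)) *
      (σ ^ j.val) (w.coeff (k - j))) * h1

/-- `F` acts coordinatewise; `a ∈ F` is identified with `a z⁰`. -/
noncomputable instance : Algebra F (CyclicAlgebra σ u) where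
  smul a x := ⟨fun k => algebraMap F K a * x.coeff k⟩
  algebraMap :=
    { toFun := fun a => ⟨fun k => if k.val = 0 then algebraMap F K a else 0⟩
      map_one' := by ext k; simp [coeff_one]
      map_zero' := by ext k; simp
      map_add' := by intro a b; ext k; simp only [coeff_add]; split_ifs <;> simp
      map_mul' := by
        intro a b
        ext k
        have : NeZero (Module.finrank F K) := ⟨Module.finrank_pos.ne'⟩
        rw [coeff_mul, Finset.sum_eq_single 0]
        · simp
        · intro i _ hi
          have : i.val ≠ 0 := fun h => hi (Fin.ext (by simpa using h))
          simp [this]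
        · simp }
  commutes' a x := by
    ext k
    have : NeZero (Module.finrank F K) := ⟨Module.finrank_pos.ne'⟩
    simp only [RingHom.coe_mk, MonoidHom.coe_mk, OneHom.coe_mk, coeff_mul]
    rw [Finset.sum_eq_single 0, Finset.sum_eq_single k]
    · simp [mul_comm]
    · intro i _ hi
      have : (k - i).val ≠ 0 := fun h =>
        hi (sub_eq_zero.mp (Fin.ext (by simpa using h) : k - i = 0)).symm
      simp [this]
    · simp
    · intro i _ hi
      have : i.val ≠ 0 := fun h => hi (Fin.ext (by simpa using h))
      simp [this]
    · simp
  smul_def' a x := by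
    ext k
    have : NeZero (Module.finrank F K) := ⟨Module.finrank_pos.ne'⟩
    simp only [RingHom.coe_mk, MonoidHom.coe_mk, OneHom.coe_mk, coeff_mul]
    rw [Finset.sum_eq_single 0]
    · simp [HSMul.hSMul]
    · intro i _ hi
      have : i.val ≠ 0 := fun h => hi (Fin.ext (by simpa using h))
      simp [this]
    · simp

theorem coeff_algebraMap (a : F) (k) : (algebraMap F (CyclicAlgebra σ u) a).coeff k =
    if k.val = 0 then algebraMap F K a else 0 := rfl

end CyclicAlgebra

/-- The natural order `Λ = 𝓞_K ⊕ 𝓞_K z ⊕ ⋯ ⊕ 𝓞_K z^{n-1}` of the cyclic algebra `(K/F, σ, u)`,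
where `u ∈ 𝓞_F`, as an `𝓞_F`-subalgebra of `(K/F, σ, u)`. -/
noncomputable def naturalOrder {F K : Type*} [Field F] [Field K] [Algebra F K]
    [FiniteDimensional F K] [IsGalois F K] (σ : K ≃ₐ[F] K) (u : 𝓞 F) :
    Subalgebra (𝓞 F) (CyclicAlgebra σ (u : F)) where
  carrier := {x | ∀ j, ∃ c : 𝓞 K, x.coeff j = (c : K)}
  add_mem' := by
    intro x y hx hy j
    obtain ⟨a, ha⟩ := hx j
    obtain ⟨b, hb⟩ := hy j
    exact ⟨a + b, by simp [ha, hb]⟩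
  algebraMap_mem' := by
    intro r j
    rw [IsScalarTower.algebraMap_apply (𝓞 F) F, CyclicAlgebra.coeff_algebraMap]
    split_ifs
    · exact ⟨algebraMap (𝓞 F) (𝓞 K) r, rfl⟩
    · exact ⟨0, by simp⟩
  mul_mem' := by
    intro x y hx hy k
    choose a ha using hx
    choose b hb using hy
    refine ⟨∑ i, (if i ≤ k then 1 else algebraMap (𝓞 F) (𝓞 K) u) *
      (a i * NumberField.RingOfIntegers.mapRingHom (σ ^ i.val) (b (k - i))), ?_⟩
    rw [CyclicAlgebra.coeff_mul]
    refine Eq.trans ?_ (map_sum (algebraMap (𝓞 K) K) _ _).symm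
    refine Finset.sum_congr rfl fun i _ => ?_
    rw [map_mul, map_mul, ha, hb]
    congr 1
    split_ifs
    · simp
    · rfl

/-- The two-sided ideal `IΛ` of the natural order `Λ` generated by an ideal `I` of `𝓞_F`. -/
noncomputable def naturalOrder.extend {F K : Type*} [Field F] [Field K] [Algebra F K]
    [FiniteDimensional F K] [IsGalois F K] (σ : K ≃ₐ[F] K) (u : 𝓞 F) (I : Ideal (𝓞 F)) :
    TwoSidedIdeal (naturalOrder σ u) :=
  TwoSidedIdeal.span (algebraMap (𝓞 F) (naturalOrder σ u) '' (I : Set (𝓞 F)))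

/-! Fix `t ≥ 1` and put `R = 𝓞 F ⧸ q ^ t` and `S = 𝓞 K ⧸ q ^ t 𝓞 K`. If the product of the
conjugates of some `w` is congruent to `u` modulo `q ^ t`, then `Λ` acts `R`-linearly on `S`: `𝓞 K`
by multiplication and `z` by `b ↦ w σ(b)`. Such a `w` exists (`exists_prod_sub_mem_map_pow`): norms
and traces of finite fields are surjective, the norm starts an induction on the exponent and the
trace carries it on. Choose `x` with conjugates pairwise incongruent modulo `q`. Their Vandermonde
matrix is invertible over `S`, so the powers of `x` form an `R`-basis of `S` (`exists_basis_pow`).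
On this basis the action of `∑ c_i z^i` is the Vandermonde matrix applied to the `c_i`, up to unit
factors. Hence `Λ → End_R(S) ≅ M_n(R)` is onto, with kernel the elements whose coordinates lie in `q
^ t 𝓞 K` (`exists_surjective_matrix`), and this kernel is `q ^ t Λ` (`mem_extend_iff`). For the
ideals, matrix units show that a two-sided ideal containing `q ^ s Λ` is generated by its trace on
`𝓞 F`. That trace divides `q ^ s`, so it is a power of `q`. -/

/-! ### Vandermonde determinants and ideals over matrix rings. -/

theorem Matrix.isUnit_det_vandermonde {S : Type*} [CommRing S] {n : ℕ} (v : Fin n → S)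
    (h : ∀ i j, i ≠ j → IsUnit (v i - v j)) : IsUnit (Matrix.vandermonde v).det := by
  rw [Matrix.det_vandermonde]
  refine IsUnit.prod_univ_iff.2 fun i => IsUnit.prod_iff.2 fun j hj => h j i ?_
  exact (Finset.mem_Ioi.1 hj).ne'

/-- A surjective algebra homomorphism identifies the quotient by a two-sided ideal equal to its
kernel with its target. -/
noncomputable def TwoSidedIdeal.quotientEquivOfMemIff {R A B : Type*} [CommRing R] [Ring A] [Ring B]
    [Algebra R A] [Algebra R B] (I : TwoSidedIdeal A) (f : A →ₐ[R] B)
    (hf : Function.Surjective f) (h : ∀ x, x ∈ I ↔ f x = 0) : I.ringCon.Quotient ≃ₐ[R] B :=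
  AlgEquiv.ofBijective
    (I.ringCon.liftₐ f fun {x y} hxy => by
      have := (h _).1 ((I.rel_iff x y).1 hxy)
      rw [map_sub, sub_eq_zero] at this
      exact this) <| by
    constructor
    · intro a b
      obtain ⟨a, rfl⟩ := I.ringCon.mk'_surjective a
      obtain ⟨b, rfl⟩ := I.ringCon.mk'_surjective b
      intro hab
      refine (I.ringCon.eq).2 ((I.rel_iff _ _).2 ((h _).2 ?_))
      rw [map_sub, sub_eq_zero]
      exact hab
    · intro b
      obtain ⟨a, rfl⟩ := hf b
      exact ⟨I.ringCon.mk' a, rfl⟩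

/-- A two-sided ideal containing the kernel of a surjection onto a matrix ring over a quotient of
the base ring is generated by its intersection with the base ring. -/
theorem TwoSidedIdeal.eq_span_comap_of_surjective_matrix {R A : Type*} [CommRing R] [Ring A]
    [Algebra R A] {n : Type*} [Fintype n] [DecidableEq n] [Nonempty n] (I : Ideal R)
    (f : A →ₐ[R] Matrix n n (R ⧸ I)) (hf : Function.Surjective f) (J : TwoSidedIdeal A)
    (hker : ∀ x, f x = 0 → x ∈ TwoSidedIdeal.span (algebraMap R A '' (I : Set R)))
    (hJ : TwoSidedIdeal.span (algebraMap R A '' (I : Set R)) ≤ J) (K : Ideal R) (hK : ∀ r, r ∈ K ↔ algebraMap R A r ∈ J) :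
    J = TwoSidedIdeal.span (algebraMap R A '' (K : Set R)) := by
  have hlift : ∀ x y, f x = f y → y ∈ J → x ∈ J := fun x y hxy hy => by
    have := J.add_mem (hJ (hker (x - y) (by rw [map_sub, hxy, sub_self]))) hy
    rwa [sub_add_cancel] at this
  have hIK : TwoSidedIdeal.span (algebraMap R A '' (I : Set R)) ≤
      TwoSidedIdeal.span (algebraMap R A '' (K : Set R)) :=
    TwoSidedIdeal.span_mono (Set.image_mono fun r hr =>
      (hK r).2 (hJ (TwoSidedIdeal.subset_span ⟨r, hr, rfl⟩)))
  choose g hg using hf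
  refine le_antisymm (fun x hx => ?_) (TwoSidedIdeal.span_le.2 ?_)
  · have hentry : ∀ i j, ∃ r ∈ K, Ideal.Quotient.mk I r = f x i j := by
      intro i j
      obtain ⟨r, hr⟩ := Ideal.Quotient.mk_surjective (f x i j)
      -- The sum `∑ k, E_ki X E_jk` is the scalar matrix `X_ij`. It thus lifts both to an element of
      -- `J` and to `r`, and `J` is a union of fibres of `f`.
      refine ⟨r, (hK r).2 (hlift _ (∑ k, g (Matrix.single k i 1) * x * g (Matrix.single j k 1)) ?_
        (sum_mem fun k _ => J.mul_mem_right _ _ (J.mul_mem_left _ _ hx))), hr⟩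
      simp only [map_sum, map_mul, hg, AlgHom.commutes]
      ext a b
      rw [Matrix.sum_apply, Matrix.algebraMap_matrix_apply]
      by_cases hab : a = b
      · subst hab
        rw [Finset.sum_eq_single a]
        · simp [hr]
        · intro k _ hk
          simp [hk]
        · simp
      · rw [if_neg hab]
        refine (Finset.sum_eq_zero fun k _ => ?_).symm
        by_cases hk : k = a
        · subst hk
          simp [hab]
        · simp [hk]
    choose r hrK hr using hentry
    have h0 : f (∑ i, ∑ j, algebraMap R A (r i j) * g (Matrix.single i j 1)) = f x := by
      simp only [map_sum, map_mul, hg, AlgHom.commutes]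
      conv_rhs => rw [Matrix.matrix_eq_sum_single (f x)]
      refine Finset.sum_congr rfl fun i _ => Finset.sum_congr rfl fun j _ => ?_
      rw [← Algebra.smul_def, Matrix.smul_single, Algebra.smul_def, mul_one, ← hr]
      rfl
    have h1 := hIK (hker (x - _) (by rw [map_sub, h0, sub_self]))
    rw [← sub_add_cancel x (∑ i, ∑ j, algebraMap R A (r i j) * g (Matrix.single i j 1))]
    exact TwoSidedIdeal.add_mem _ h1 (sum_mem fun i _ => sum_mem fun j _ =>
      TwoSidedIdeal.mul_mem_right _ _ _ (TwoSidedIdeal.subset_span ⟨r i j, hrK i j, rfl⟩))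
  · rintro _ ⟨r, hr, rfl⟩
    exact (hK r).1 hr

/-! ### Integral coordinates and the universal property of the natural order. -/

namespace naturalOrder

variable {F K : Type*} [Field F] [NumberField F] [Field K] [NumberField K] [Algebra F K]
  [IsGalois F K]
  {σ : K ≃ₐ[F] K} {u : 𝓞 F}

/-- The coordinates of an element of the natural order, as algebraic integers. -/
noncomputable def coord (x : naturalOrder σ u) (j : Fin (Module.finrank F K)) : 𝓞 K :=
  (x.2 j).choose

theorem coe_coord (x : naturalOrder σ u) (j) :
    algebraMap (𝓞 K) K (coord x j) = (x : CyclicAlgebra σ (u : F)).coeff j :=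
  (x.2 j).choose_spec.symm

/-- The element of the natural order with given coordinates. -/
def ofCoord (c : Fin (Module.finrank F K) → 𝓞 K) : naturalOrder σ u :=
  ⟨⟨fun j => c j⟩, fun j => ⟨c j, rfl⟩⟩

@[simp] theorem coord_ofCoord (c : Fin (Module.finrank F K) → 𝓞 K) :
    coord (ofCoord c : naturalOrder σ u) = c := by
  ext j
  exact coe_coord _ _

theorem coord_injective : Function.Injective
    (coord : naturalOrder σ u → Fin (Module.finrank F K) → 𝓞 K) := by
  intro x y h
  refine Subtype.ext (CyclicAlgebra.ext (funext fun j => ?_))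
  rw [← coe_coord, ← coe_coord, h]

theorem coord_add (x y : naturalOrder σ u) (j) : coord (x + y) j = coord x j + coord y j := by
  apply NumberField.RingOfIntegers.ext
  refine (coe_coord _ _).trans (Eq.trans ?_ (map_add (algebraMap (𝓞 K) K) _ _).symm)
  rw [coe_coord, coe_coord]
  rfl

theorem coord_algebraMap (r : 𝓞 F) (j) : coord (algebraMap (𝓞 F) (naturalOrder σ u) r) j =
    if j.val = 0 then algebraMap (𝓞 F) (𝓞 K) r else 0 := by
  apply NumberField.RingOfIntegers.ext
  refine (coe_coord _ _).trans ?_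
  refine (CyclicAlgebra.coeff_algebraMap (σ := σ) (u := (u : F)) (r : F) j).trans ?_
  split_ifs
  · rfl
  · simp

theorem coord_mul (x y : naturalOrder σ u) (k) : coord (x * y) k =
    ∑ i, (if i ≤ k then 1 else algebraMap (𝓞 F) (𝓞 K) u) *
      (coord x i * (galRestrict (𝓞 F) F K (𝓞 K) σ ^ i.val) (coord y (k - i))) := by
  apply NumberField.RingOfIntegers.ext
  refine (coe_coord _ _).trans ?_
  refine (CyclicAlgebra.coeff_mul _ _ k).trans ?_
  refine Eq.trans ?_ (map_sum (algebraMap (𝓞 K) K) _ _).symm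
  refine Finset.sum_congr rfl fun i _ => ?_
  rw [map_mul, map_mul, ← map_pow, algebraMap_galRestrict_apply, coe_coord, coe_coord]
  congr 1
  split_ifs
  · simp
  · rfl

/-- The universal property of the natural order: an algebra homomorphism from `𝓞 K` and an
element `T` satisfying the relations of `z` extend to the natural order. -/
noncomputable def lift {E : Type*} [Ring E] [Algebra (𝓞 F) E] (L : 𝓞 K →ₐ[𝓞 F] E) (T : E)
    (hT : ∀ b, T * L b = L (galRestrict (𝓞 F) F K (𝓞 K) σ b) * T)
    (hu : T ^ Module.finrank F K = algebraMap (𝓞 F) E u) : naturalOrder σ u →ₐ[𝓞 F] E :=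
  have : NeZero (Module.finrank F K) := ⟨Module.finrank_pos.ne'⟩
  have hpow : ∀ (i : ℕ) b, T ^ i * L b = L ((galRestrict (𝓞 F) F K (𝓞 K) σ ^ i) b) * T ^ i := by
    intro i
    induction i with
    | zero => simp
    | succ i ih =>
      intro b
      rw [pow_succ, mul_assoc, hT, ← mul_assoc, ih, mul_assoc]
      rfl
  have halg : ∀ r, L (algebraMap (𝓞 F) (𝓞 K) r) = algebraMap (𝓞 F) E r := L.commutes
  -- Subtraction in `Fin n` wraps around, so the total exponent is `k` or `n + k`; in the second
  -- case `T ^ n` contributes the carry `u`.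
  have hcarry : ∀ i k : Fin (Module.finrank F K), T ^ i.val * T ^ (k - i).val =
      L (if i ≤ k then 1 else algebraMap (𝓞 F) (𝓞 K) u) * T ^ k.val := by
    intro i k
    have hi := i.isLt
    have hk := k.isLt
    rw [← pow_add, Fin.sub_def]
    simp only [Fin.le_def]
    split_ifs with h
    · rw [map_one, one_mul]
      have : Module.finrank F K - i.val + k.val = Module.finrank F K + (k.val - i.val) := by omega
      simp only [this, Nat.add_mod_left]
      rw [Nat.mod_eq_of_lt (by omega)]
      congr 1
      omega
    · rw [Nat.mod_eq_of_lt (by omega), halg, ← hu, ← pow_add]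
      congr 1
      omega
  have hsum : ∀ r : 𝓞 F, (∑ i, L (coord (algebraMap (𝓞 F) (naturalOrder σ u) r) i) * T ^ i.val) =
      algebraMap (𝓞 F) E r := by
    intro r
    rw [Finset.sum_eq_single 0]
    · simp [coord_algebraMap]
    · intro i _ hi
      have : i.val ≠ 0 := fun h => hi (Fin.ext (by simpa using h))
      simp [coord_algebraMap, this]
    · simp
  { toFun := fun x => ∑ i, L (coord x i) * T ^ i.val
    map_one' := by simpa using hsum 1
    map_zero' := by simpa using hsum 0
    map_add' := by
      intro x y
      simp only [coord_add, map_add, add_mul, Finset.sum_add_distrib]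
    commutes' := hsum
    map_mul' := by
      intro x y
      simp only [coord_mul, map_sum, Finset.sum_mul]
      rw [Finset.sum_comm]
      refine Finset.sum_congr rfl fun i _ => ?_
      rw [Finset.mul_sum]
      conv_rhs => rw [← Equiv.sum_comp (Equiv.subRight i)]
      refine Finset.sum_congr rfl fun k _ => ?_
      rw [Equiv.subRight_apply, mul_assoc, ← mul_assoc (T ^ i.val), hpow, mul_assoc, hcarry,
        ← mul_assoc, ← mul_assoc, ← map_mul, ← mul_assoc, ← map_mul, mul_comm (_ * _) (ite _ _ _),
        mul_assoc (ite _ _ _)]  }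

theorem lift_apply {E : Type*} [Ring E] [Algebra (𝓞 F) E] (L : 𝓞 K →ₐ[𝓞 F] E) (T : E)
    (hT : ∀ b, T * L b = L (galRestrict (𝓞 F) F K (𝓞 K) σ b) * T)
    (hu : T ^ Module.finrank F K = algebraMap (𝓞 F) E u) (x : naturalOrder σ u) :
    lift L T hT hu x = ∑ i, L (coord x i) * T ^ i.val := rfl

theorem coord_ofCoord_mul (b : 𝓞 K) (x : naturalOrder σ u) (j) :
    coord (ofCoord (fun j => if j.val = 0 then b else 0) * x) j = b * coord x j := by
  have : NeZero (Module.finrank F K) := ⟨Module.finrank_pos.ne'⟩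
  rw [coord_mul, Finset.sum_eq_single 0]
  · simp
  · intro i _ hi
    have : i.val ≠ 0 := fun h => hi (Fin.ext (by simpa using h))
    simp only [coord_ofCoord, if_neg this, zero_mul, mul_zero]
  · simp

theorem algebraMap_eq_ofCoord (r : 𝓞 F) : algebraMap (𝓞 F) (naturalOrder σ u) r =
    ofCoord (fun j => if j.val = 0 then algebraMap (𝓞 F) (𝓞 K) r else 0) :=
  coord_injective (funext fun j => by rw [coord_algebraMap, coord_ofCoord])

theorem coord_sum {ι : Type*} (s : Finset ι) (f : ι → naturalOrder σ u) (j) :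
    coord (∑ i ∈ s, f i) j = ∑ i ∈ s, coord (f i) j :=
  map_sum (AddMonoidHom.mk' (fun x => coord x j) fun x y => coord_add x y j) f s

/-- Each term `c z^j` with `c ∈ I 𝓞 K` is a sum of products `b · a · z^j` with `a ∈ I`, so it lies
in the ideal generated by `I`. -/
theorem mem_extend_of_coord_mem {I : Ideal (𝓞 F)} {x : naturalOrder σ u}
    (h : ∀ j, coord x j ∈ I.map (algebraMap (𝓞 F) (𝓞 K))) : x ∈ extend σ u I := by
  classical
  have hsingle : ∀ j, ∀ c ∈ I.map (algebraMap (𝓞 F) (𝓞 K)),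
      (ofCoord (Pi.single j c) : naturalOrder σ u) ∈ extend σ u I := by
    intro j c hc
    induction hc using Submodule.span_induction with
    | mem c hc =>
      obtain ⟨a, ha, rfl⟩ := hc
      have : (ofCoord (Pi.single j (algebraMap (𝓞 F) (𝓞 K) a)) : naturalOrder σ u) =
          algebraMap (𝓞 F) _ a * ofCoord (Pi.single j 1) := by
        refine coord_injective (funext fun k => ?_)
        rw [algebraMap_eq_ofCoord, coord_ofCoord_mul, coord_ofCoord, coord_ofCoord, Pi.single_apply, Pi.single_apply]
        split_ifs <;> simp
      rw [this]
      exact TwoSidedIdeal.mul_mem_right _ _ _ (TwoSidedIdeal.subset_span ⟨a, ha, rfl⟩)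
    | zero =>
      convert (extend σ u I).zero_mem
      refine coord_injective (funext fun k => ?_)
      have := coord_algebraMap (σ := σ) (u := u) 0 k
      simp_all
    | add c d _ _ hc hd =>
      convert TwoSidedIdeal.add_mem _ hc hd
      refine coord_injective (funext fun k => ?_)
      simp [coord_add, Pi.single_add]
    | smul b c _ hc =>
      convert TwoSidedIdeal.mul_mem_left _
        (ofCoord (fun j => if j.val = 0 then b else 0)) _ hc
      refine coord_injective (funext fun k => ?_)
      rw [coord_ofCoord_mul, coord_ofCoord, coord_ofCoord, Pi.single_apply, Pi.single_apply]
      split_ifs <;> simp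
  have hx : x = ∑ j, ofCoord (Pi.single j (coord x j)) := by
    refine coord_injective (funext fun k => ?_)
    simp [coord_sum]
  rw [hx]
  exact sum_mem fun j _ => hsingle j _ (h j)

end naturalOrder

/-! ### Galois action on the residue field and norms modulo prime powers. -/

namespace NumberField

variable {F K : Type*} [Field F] [NumberField F] [Field K] [NumberField K] [Algebra F K]

omit [NumberField F] [NumberField K] in
theorem algEquiv_mem_map (τ : 𝓞 K ≃ₐ[𝓞 F] 𝓞 K) (I : Ideal (𝓞 F)) {b : 𝓞 K}
    (hb : b ∈ I.map (algebraMap (𝓞 F) (𝓞 K))) : τ b ∈ I.map (algebraMap (𝓞 F) (𝓞 K)) := by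
  have h := Ideal.mem_map_of_mem (τ : 𝓞 K →+* 𝓞 K) hb
  rw [Ideal.map_map] at h
  have hτ : (τ : 𝓞 K →+* 𝓞 K).comp (algebraMap (𝓞 F) (𝓞 K)) = algebraMap (𝓞 F) (𝓞 K) :=
    RingHom.ext fun r => τ.commutes r
  rwa [hτ] at h

theorem finrank_ringOfIntegers : Module.finrank (𝓞 F) (𝓞 K) = Module.finrank F K :=
  (IsFractionRing.finrank_eq (𝓞 F) F (𝓞 K) K).symm

/-- This count gives the residue degree of an inert prime, and later turns linear independence into
spanning. -/
theorem card_quotient_map (I : Ideal (𝓞 F)) :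
    Nat.card (𝓞 K ⧸ I.map (algebraMap (𝓞 F) (𝓞 K))) =
      Nat.card (𝓞 F ⧸ I) ^ Module.finrank F K := by
  have h := Ideal.absNorm_algebraMap (𝓞 F) (S := 𝓞 K) I
  rwa [finrank_ringOfIntegers] at h

variable [IsGalois F K]

theorem bijective_galRestrict_pow {σ : K ≃ₐ[F] K} (hσ : ∀ τ : K ≃ₐ[F] K, τ ∈ Subgroup.zpowers σ) :
    Function.Bijective fun i : Fin (Module.finrank F K) =>
      galRestrict (𝓞 F) F K (𝓞 K) σ ^ i.val := by
  have hord : orderOf σ = Module.finrank F K := by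
    rw [orderOf_eq_card_of_forall_mem_zpowers hσ, IsGalois.card_aut_eq_finrank]
  have hcard : Nat.card (Fin (Module.finrank F K)) = Nat.card (K ≃ₐ[F] K) := by
    rw [IsGalois.card_aut_eq_finrank, Nat.card_fin]
  have h : Function.Bijective fun i : Fin (Module.finrank F K) => σ ^ i.val := by
    rw [Nat.bijective_iff_injective_and_card]
    refine ⟨fun i j hij => ?_, hcard⟩
    exact Fin.ext (pow_injOn_Iio_orderOf (by simp [hord]) (by simp [hord]) hij)
  convert (galRestrict (𝓞 F) F K (𝓞 K)).bijective.comp h using 1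
  ext i
  simp

open Pointwise in
-- Since `P` is extended from `q`, every automorphism stabilizes it, so the decomposition group is
-- the whole group. It always surjects onto the residue automorphism group. Counting `𝓞 K ⧸ P` gives
-- residue degree `[K : F]`, so both groups have the same order.
theorem exists_bijective_residue_aut (q : Ideal (𝓞 F)) [q.IsMaximal] (P : Ideal (𝓞 K))
    [P.IsMaximal] [P.LiesOver q] (hP : P = q.map (algebraMap (𝓞 F) (𝓞 K)))
    [Finite (𝓞 F ⧸ q)] [Finite (𝓞 K ⧸ P)] :
    ∃ f : (𝓞 K ≃ₐ[𝓞 F] 𝓞 K) → ((𝓞 K ⧸ P) ≃ₐ[𝓞 F ⧸ q] (𝓞 K ⧸ P)),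
      Function.Bijective f ∧ ∀ g b, f g (Ideal.Quotient.mk P b) = Ideal.Quotient.mk P (g b) := by
  let := Ideal.Quotient.field q
  let := Ideal.Quotient.field P
  have hinv := Algebra.isInvariant_of_isGalois' (𝓞 F) F K (𝓞 K)
  have hfin : Finite (𝓞 K ≃ₐ[𝓞 F] 𝓞 K) :=
    Finite.of_equiv _ (galRestrict (𝓞 F) F K (𝓞 K)).toEquiv
  have hstab : ∀ g : 𝓞 K ≃ₐ[𝓞 F] 𝓞 K, g ∈ MulAction.stabilizer (𝓞 K ≃ₐ[𝓞 F] 𝓞 K) P := by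
    intro g
    have hle : ∀ h : 𝓞 K ≃ₐ[𝓞 F] 𝓞 K, ∀ b ∈ P, h b ∈ P := by
      rw [hP]
      exact fun h b hb => algEquiv_mem_map h q hb
    rw [MulAction.mem_stabilizer_iff]
    ext b
    rw [Ideal.mem_pointwise_smul_iff_inv_smul_mem]
    refine ⟨fun hb => ?_, hle g⁻¹ b⟩
    have := hle g _ hb
    rwa [← AlgEquiv.smul_def, smul_inv_smul] at this
  have hcard : Nat.card (𝓞 K ≃ₐ[𝓞 F] 𝓞 K) = Nat.card ((𝓞 K ⧸ P) ≃ₐ[𝓞 F ⧸ q] (𝓞 K ⧸ P)) := by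
    rw [IsGalois.card_aut_eq_finrank, ← Nat.card_congr (galRestrict (𝓞 F) F K (𝓞 K)).toEquiv,
      IsGalois.card_aut_eq_finrank]
    refine Nat.pow_right_injective (Finite.one_lt_card (α := 𝓞 F ⧸ q)) ?_
    have h := card_quotient_map (K := K) q
    rw [← hP] at h
    exact h.symm.trans (Module.natCard_eq_pow_finrank (K := 𝓞 F ⧸ q) (V := 𝓞 K ⧸ P))
  refine ⟨fun g => Ideal.Quotient.stabilizerHom P q _ ⟨g, hstab g⟩, ?_, fun g b => rfl⟩
  refine (Nat.bijective_iff_surjective_and_card _).2 ⟨fun φ => ?_, hcard⟩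
  obtain ⟨g, hg⟩ := Ideal.Quotient.stabilizerHom_surjective (𝓞 K ≃ₐ[𝓞 F] 𝓞 K) q P φ
  exact ⟨g.1, hg⟩

variable {σ : K ≃ₐ[F] K} (hσ : ∀ τ : K ≃ₐ[F] K, τ ∈ Subgroup.zpowers σ) (q : Ideal (𝓞 F))
  [hq : q.IsPrime] (hq0 : q ≠ ⊥) (hinert : (q.map (algebraMap (𝓞 F) (𝓞 K))).IsPrime)

include hσ hq0 hinert

/-- Modulo `P`, the powers of `σ` run once through the residue Galois group, so each claim is one
about finite fields: a generator of the unit group has distinct conjugates, and trace and norm are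
surjective. -/
theorem exists_residue_galois :
    (∃ x : 𝓞 K, ∀ i j : Fin (Module.finrank F K), i ≠ j →
      (galRestrict (𝓞 F) F K (𝓞 K) σ ^ i.val) x - (galRestrict (𝓞 F) F K (𝓞 K) σ ^ j.val) x ∉
        q.map (algebraMap (𝓞 F) (𝓞 K))) ∧
    (∃ e : 𝓞 K, ∑ i : Fin (Module.finrank F K), (galRestrict (𝓞 F) F K (𝓞 K) σ ^ i.val) e - 1 ∈
        q.map (algebraMap (𝓞 F) (𝓞 K))) ∧
    ∀ u : 𝓞 F, ∃ w : 𝓞 K,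
      ∏ i : Fin (Module.finrank F K), (galRestrict (𝓞 F) F K (𝓞 K) σ ^ i.val) w -
        algebraMap (𝓞 F) (𝓞 K) u ∈ q.map (algebraMap (𝓞 F) (𝓞 K)) := by
  have hqm : q.IsMaximal := hq.isMaximal hq0
  obtain ⟨P, hP⟩ : ∃ P, P = q.map (algebraMap (𝓞 F) (𝓞 K)) := ⟨_, rfl⟩
  rw [← hP] at hinert ⊢
  have hP0 : P ≠ ⊥ := by
    rw [hP, Ne, Ideal.map_eq_bot_iff_of_injective (FaithfulSMul.algebraMap_injective _ _)]
    exact hq0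
  have hPm : P.IsMaximal := hinert.isMaximal hP0
  have hover : P.LiesOver q := ⟨by
    rw [hP, Ideal.under_def, Ideal.comap_map_eq_self_of_faithfullyFlat]⟩
  have : Finite (𝓞 F ⧸ q) := Ideal.finiteQuotientOfFreeOfNeBot q hq0
  have : Finite (𝓞 K ⧸ P) := Ideal.finiteQuotientOfFreeOfNeBot P hP0
  let := Ideal.Quotient.field q
  let := Ideal.Quotient.field P
  obtain ⟨f, hf, hfmk⟩ := exists_bijective_residue_aut q P hP
  have hbij := hf.comp (bijective_galRestrict_pow hσ)
  refine ⟨?_, ?_, fun u => ?_⟩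
  · obtain ⟨ζ, hζ⟩ := IsCyclic.exists_generator (α := (𝓞 K ⧸ P)ˣ)
    obtain ⟨x, hx⟩ := Ideal.Quotient.mk_surjective (ζ : 𝓞 K ⧸ P)
    -- Two residue automorphisms that agree on the generator `ζ` agree on all its powers, hence
    -- everywhere.
    refine ⟨x, fun i j hij hmem => hij (hbij.1 ?_)⟩
    rw [← Ideal.Quotient.eq, ← hfmk, ← hfmk, hx] at hmem
    refine AlgEquiv.ext fun y => ?_
    rcases eq_or_ne y 0 with rfl | hy
    · simp
    · obtain ⟨m, hm⟩ := Subgroup.mem_zpowers_iff.1 (hζ (Units.mk0 y hy))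
      have hm' : (ζ : 𝓞 K ⧸ P) ^ m = y := by
        rw [← Units.val_zpow_eq_zpow_val, hm, Units.val_mk0]
      rw [← hm']
      simp only [Function.comp_apply, map_zpow₀, hmem]
  · obtain ⟨y, hy⟩ := Algebra.trace_surjective (𝓞 F ⧸ q) (𝓞 K ⧸ P) 1
    obtain ⟨e, rfl⟩ := Ideal.Quotient.mk_surjective y
    refine ⟨e, ?_⟩
    rw [← Ideal.Quotient.eq, map_one, map_sum, ← map_one (algebraMap (𝓞 F ⧸ q) (𝓞 K ⧸ P)), ← hy,
      trace_eq_sum_automorphisms, ← hbij.sum_comp]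
    simp only [Function.comp_apply, hfmk]
  · obtain ⟨y, hy⟩ := FiniteField.norm_surjective (𝓞 F ⧸ q) (𝓞 K ⧸ P) (Ideal.Quotient.mk q u)
    obtain ⟨w, rfl⟩ := Ideal.Quotient.mk_surjective y
    refine ⟨w, ?_⟩
    have hu : Ideal.Quotient.mk P (algebraMap (𝓞 F) (𝓞 K) u) =
      algebraMap (𝓞 F ⧸ q) (𝓞 K ⧸ P) (Ideal.Quotient.mk q u) := rfl
    rw [← Ideal.Quotient.eq, map_prod, hu, ← hy,
      Algebra.norm_eq_prod_automorphisms, ← hbij.prod_comp]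
    simp only [Function.comp_apply, hfmk]

omit hσ hq0 hinert in
-- First-order expansion: the norm of a small perturbation of `1` is governed by a trace.
theorem exists_prod_one_add_mul {R ι : Type*} [CommRing R] (s : Finset ι) (a : R) (z : ι → R) :
    ∃ r, ∏ i ∈ s, (1 + a * z i) = 1 + a * ∑ i ∈ s, z i + a ^ 2 * r := by
  classical
  induction s using Finset.induction_on with
  | empty => exact ⟨0, by simp⟩
  | insert i s hi ih =>
    obtain ⟨r, hr⟩ := ih
    refine ⟨r + z i * ∑ j ∈ s, z j + a * z i * r, ?_⟩
    rw [Finset.prod_insert hi, Finset.sum_insert hi, hr]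
    ring

/-- Units of the base are norms modulo every power of an inert prime. -/
theorem exists_prod_sub_mem_map_pow {u : 𝓞 F} (hu : u ∉ q) (t : ℕ) :
    ∃ w : 𝓞 K, ∏ i : Fin (Module.finrank F K), (galRestrict (𝓞 F) F K (𝓞 K) σ ^ i.val) w -
      algebraMap (𝓞 F) (𝓞 K) u ∈ (q ^ (t + 1)).map (algebraMap (𝓞 F) (𝓞 K)) := by
  obtain ⟨-, ⟨e, he⟩, hbase⟩ := exists_residue_galois hσ q hq0 hinert
  induction t with
  | zero => simpa using hbase u
  | succ t ih =>
    obtain ⟨w, hw⟩ := ih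
    have hinv := Algebra.isInvariant_of_isGalois' (𝓞 F) F K (𝓞 K)
    have hfin : Fintype (𝓞 K ≃ₐ[𝓞 F] 𝓞 K) := Fintype.ofEquiv _ (galRestrict (𝓞 F) F K (𝓞 K)).toEquiv
    -- The automorphisms permute the factors of the product, so it is invariant and comes from `𝓞
    -- F`.
    obtain ⟨N, hN⟩ : ∃ N, algebraMap (𝓞 F) (𝓞 K) N =
        ∏ i : Fin (Module.finrank F K), (galRestrict (𝓞 F) F K (𝓞 K) σ ^ i.val) w := by
      refine hinv.isInvariant _ fun g => ?_
      rw [(bijective_galRestrict_pow hσ).prod_comp fun h => h w, AlgEquiv.smul_def, map_prod]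
      exact (Group.mulLeft_bijective g).prod_comp fun h => h w
    rw [← hN, ← map_sub, ← Ideal.mem_comap, Ideal.comap_map_eq_self_of_faithfullyFlat] at hw
    obtain ⟨c, i, hi, hci⟩ := (hq.isMaximal hq0).exists_inv hu
    obtain ⟨r, hr⟩ := exists_prod_one_add_mul Finset.univ
      (algebraMap (𝓞 F) (𝓞 K) (-(N - u) * c))
      fun i : Fin (Module.finrank F K) => (galRestrict (𝓞 F) F K (𝓞 K) σ ^ i.val) e
    -- Newton correction: `e` has trace `1` and `c` inverts `u`, hence also `N`, modulo `q`. The new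
    -- norm is `N - (N - u) N c ≡ u` modulo `q ^ (t + 2)`.
    refine ⟨w * (1 + algebraMap (𝓞 F) (𝓞 K) (-(N - u) * c) * e), ?_⟩
    simp only [map_mul, map_add, map_one, AlgEquiv.commutes, Finset.prod_mul_distrib] at hr ⊢
    rw [hr, ← hN, pow_succ, Ideal.map_mul]
    set I := (q ^ (t + 1)).map (algebraMap (𝓞 F) (𝓞 K))
    set P := q.map (algebraMap (𝓞 F) (𝓞 K))
    have hd : algebraMap (𝓞 F) (𝓞 K) (N - u) ∈ I := Ideal.mem_map_of_mem _ hw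
    have hd' : algebraMap (𝓞 F) (𝓞 K) (N - u) ∈ P :=
      Ideal.mem_map_of_mem _ (Ideal.pow_le_self t.succ_ne_zero hw)
    have hi' : algebraMap (𝓞 F) (𝓞 K) i ∈ P := Ideal.mem_map_of_mem _ hi
    have hci' := congrArg (algebraMap (𝓞 F) (𝓞 K)) hci
    simp only [map_neg, map_mul, map_add, map_one, map_sub] at hci' hd hd' ⊢
    generalize algebraMap (𝓞 F) (𝓞 K) N = N at *
    generalize algebraMap (𝓞 F) (𝓞 K) u = u at *
    generalize algebraMap (𝓞 F) (𝓞 K) i = i at *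
    generalize algebraMap (𝓞 F) (𝓞 K) c = c at *
    generalize ∑ i : Fin (Module.finrank F K), (galRestrict (𝓞 F) F K (𝓞 K) σ ^ i.val) e = s at *
    have h1 := Ideal.mul_mem_mul hd hi'
    have h2 := Ideal.mul_mem_mul hd hd'
    have h3 := Ideal.mul_mem_mul hd he
    have h4 := add_mem (add_mem h1 (Ideal.mul_mem_left _ (-c + N * c ^ 2 * r) h2))
      (Ideal.mul_mem_left _ (-N * c) h3)
    convert h4 using 1
    linear_combination (-(N - u)) * hci'

end NumberField

/-! ### Twisted operators and a power basis on `𝓞 K ⧸ I 𝓞 K`. -/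

namespace NumberField

variable {F K : Type*} [Field F] [NumberField F] [Field K] [NumberField K] [Algebra F K]

/-- The endomorphism of `𝓞 K ⧸ I 𝓞 K` induced by `b ↦ w * τ b`. -/
noncomputable def twistedEnd (I : Ideal (𝓞 F)) (τ : 𝓞 K ≃ₐ[𝓞 F] 𝓞 K) (w : 𝓞 K) :
    Module.End (𝓞 F ⧸ I) (𝓞 K ⧸ I.map (algebraMap (𝓞 F) (𝓞 K))) :=
  LinearMap.extendScalarsOfSurjective (R := 𝓞 F) Ideal.Quotient.mk_surjective
    (LinearMap.mulLeft (𝓞 F) (Ideal.Quotient.mk (I.map (algebraMap (𝓞 F) (𝓞 K))) w) ∘ₗ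
      (Ideal.quotientMapₐ (I.map (algebraMap (𝓞 F) (𝓞 K))) (τ : 𝓞 K →ₐ[𝓞 F] 𝓞 K)
        (fun _ hb => algEquiv_mem_map τ I hb)).toLinearMap)

omit [NumberField F] [NumberField K] in
theorem twistedEnd_mk (I : Ideal (𝓞 F)) (τ : 𝓞 K ≃ₐ[𝓞 F] 𝓞 K) (w b : 𝓞 K) :
    twistedEnd I τ w (Ideal.Quotient.mk _ b) = Ideal.Quotient.mk _ (w * τ b) := rfl

omit [NumberField F] [NumberField K] in
-- When `τ ^ m = 1` the operator power is multiplication by the norm of `w`; this yields the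
-- relation `z ^ n = u`.
theorem twistedEnd_pow_mk (I : Ideal (𝓞 F)) (τ : 𝓞 K ≃ₐ[𝓞 F] 𝓞 K) (w b : 𝓞 K) (m : ℕ) :
    (twistedEnd I τ w ^ m) (Ideal.Quotient.mk _ b) =
      Ideal.Quotient.mk _ ((∏ i : Fin m, (τ ^ i.val) w) * (τ ^ m) b) := by
  induction m with
  | zero => simp
  | succ m ih =>
    rw [pow_succ', Module.End.mul_apply, ih, twistedEnd_mk, Fin.prod_univ_succ, map_mul τ, map_prod τ]
    simp only [pow_succ', Fin.val_succ, AlgEquiv.mul_apply, Fin.val_zero, pow_zero,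
      AlgEquiv.one_apply, mul_assoc]

/-- Multiplication operators on `𝓞 K ⧸ I 𝓞 K`. -/
noncomputable def mulEnd (I : Ideal (𝓞 F)) : 𝓞 K →ₐ[𝓞 F]
    Module.End (𝓞 F ⧸ I) (𝓞 K ⧸ I.map (algebraMap (𝓞 F) (𝓞 K))) :=
  ((Algebra.lmul (𝓞 F ⧸ I) (𝓞 K ⧸ I.map (algebraMap (𝓞 F) (𝓞 K)))).restrictScalars (𝓞 F)).comp
    (Ideal.Quotient.mkₐ (𝓞 F) _)

omit [NumberField F] [NumberField K] in
theorem mulEnd_mk (I : Ideal (𝓞 F)) (c b : 𝓞 K) :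
    mulEnd I c (Ideal.Quotient.mk _ b) = Ideal.Quotient.mk _ (c * b) := rfl

omit [NumberField F] [NumberField K] in
-- An inverse modulo the maximal ideal has an error that is nilpotent modulo its `t`-th power.
theorem isUnit_mk_pow {q : Ideal (𝓞 F)} (hP : (q.map (algebraMap (𝓞 F) (𝓞 K))).IsMaximal) (t : ℕ)
    {b : 𝓞 K} (hb : b ∉ q.map (algebraMap (𝓞 F) (𝓞 K))) :
    IsUnit (Ideal.Quotient.mk ((q ^ t).map (algebraMap (𝓞 F) (𝓞 K))) b) := by
  obtain ⟨c, i, hi, hci⟩ := hP.exists_inv hb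
  have hn : IsNilpotent (Ideal.Quotient.mk ((q ^ t).map (algebraMap (𝓞 F) (𝓞 K))) i) :=
    ⟨t, by
      rw [← map_pow, Ideal.Quotient.eq_zero_iff_mem, Ideal.map_pow]
      exact Ideal.pow_mem_pow hi t⟩
  have h := hn.isUnit_one_sub
  rw [← map_one (Ideal.Quotient.mk _), ← hci, ← map_sub, add_sub_cancel_right, map_mul] at h
  exact isUnit_of_mul_isUnit_right h

/-- Applying each `τ ^ i` to a relation with coefficients from `𝓞 F` gives a Vandermonde system,
which kills the coefficients modulo `I 𝓞 K`, hence modulo `I` by faithful flatness. Spanning follows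
because the finite source and target have equal size. -/
theorem exists_basis_pow [IsGalois F K] (I : Ideal (𝓞 F)) (hI : I ≠ ⊥) (τ : 𝓞 K ≃ₐ[𝓞 F] 𝓞 K)
    (x : 𝓞 K) (hV : IsUnit (Matrix.vandermonde fun i : Fin (Module.finrank F K) =>
      Ideal.Quotient.mk (I.map (algebraMap (𝓞 F) (𝓞 K))) ((τ ^ i.val) x)).det) :
    ∃ b : Module.Basis (Fin (Module.finrank F K)) (𝓞 F ⧸ I)
      (𝓞 K ⧸ I.map (algebraMap (𝓞 F) (𝓞 K))), ∀ m, b m = Ideal.Quotient.mk _ (x ^ m.val) := by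
  set J := I.map (algebraMap (𝓞 F) (𝓞 K)) with hJ
  have hfinR : Finite (𝓞 F ⧸ I) := Ideal.finiteQuotientOfFreeOfNeBot I hI
  have hfinS : Finite (𝓞 K ⧸ J) := Ideal.finiteQuotientOfFreeOfNeBot J (by
    rw [hJ, Ne, Ideal.map_eq_bot_iff_of_injective (FaithfulSMul.algebraMap_injective _ _)]
    exact hI)
  have hli : LinearIndependent (𝓞 F ⧸ I) fun m : Fin (Module.finrank F K) =>
      Ideal.Quotient.mk J (x ^ m.val) := by
    rw [Fintype.linearIndependent_iff]
    intro g hg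
    choose r hr using fun m => Ideal.Quotient.mk_surjective (g m)
    have hsum : ∑ m, algebraMap (𝓞 F) (𝓞 K) (r m) * x ^ m.val ∈ J := by
      rw [← Ideal.Quotient.eq_zero_iff_mem, ← hg, map_sum]
      refine Finset.sum_congr rfl fun m _ => ?_
      rw [← hr]
      rfl
    have hmul : (Matrix.vandermonde fun i : Fin (Module.finrank F K) =>
        Ideal.Quotient.mk J ((τ ^ i.val) x)).mulVec
        (fun m => Ideal.Quotient.mk J (algebraMap (𝓞 F) (𝓞 K) (r m))) = 0 := by
      ext i
      have h := algEquiv_mem_map (τ ^ i.val) I hsum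
      rw [← hJ, ← Ideal.Quotient.eq_zero_iff_mem] at h
      rw [map_sum (τ ^ i.val), map_sum (Ideal.Quotient.mk J)] at h
      rw [Pi.zero_apply, ← h, Matrix.mulVec, dotProduct]
      refine Finset.sum_congr rfl fun m _ => ?_
      rw [Matrix.vandermonde_apply, ← map_pow, ← map_mul, map_mul (τ ^ i.val), AlgEquiv.commutes,
        map_pow (τ ^ i.val), mul_comm]
    have hzero := Matrix.mulVec_injective_of_isUnit ((Matrix.isUnit_iff_isUnit_det _).2 hV)
      (hmul.trans (Matrix.mulVec_zero _).symm)
    intro m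
    have h := congrFun hzero m
    rw [Pi.zero_apply, Ideal.Quotient.eq_zero_iff_mem, hJ, ← Ideal.mem_comap,
      Ideal.comap_map_eq_self_of_faithfullyFlat, ← Ideal.Quotient.eq_zero_iff_mem] at h
    rw [← hr, h]
  have hsurj : Function.Surjective (Fintype.linearCombination (𝓞 F ⧸ I)
      fun m : Fin (Module.finrank F K) => Ideal.Quotient.mk J (x ^ m.val)) := by
    refine ((Nat.bijective_iff_injective_and_card _).2 ⟨?_, ?_⟩).2
    · exact linearIndependent_iff_injective_fintypeLinearCombination.1 hli
    · rw [Nat.card_fun, Nat.card_fin, hJ, card_quotient_map]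
  refine ⟨Module.Basis.mk hli ?_, fun m => Module.Basis.mk_apply _ _ _⟩
  rw [← Fintype.range_linearCombination, LinearMap.range_eq_top.2 hsurj]

end NumberField

/-! ### The matrix representation of the natural order and its two-sided ideals. -/

open NumberField

namespace naturalOrder

variable {F K : Type*} [Field F] [NumberField F] [Field K] [NumberField K] [Algebra F K]
  [IsGalois F K] {σ : K ≃ₐ[F] K} {u : 𝓞 F}

theorem exists_surjective_matrix
    (hσ : ∀ τ : K ≃ₐ[F] K, τ ∈ Subgroup.zpowers σ) (q : Ideal (𝓞 F)) (hq : q.IsPrime) (hq0 : q ≠ ⊥)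
    (hinert : (q.map (algebraMap (𝓞 F) (𝓞 K))).IsPrime) (huq : u ∉ q) (t : ℕ) (ht : 1 ≤ t) :
    ∃ f : naturalOrder σ u →ₐ[𝓞 F]
      Matrix (Fin (Module.finrank F K)) (Fin (Module.finrank F K)) (𝓞 F ⧸ q ^ t),
      Function.Surjective f ∧
        ∀ x, f x = 0 → ∀ j, coord x j ∈ (q ^ t).map (algebraMap (𝓞 F) (𝓞 K)) := by
  set τ := galRestrict (𝓞 F) F K (𝓞 K) σ with hτ
  set J := (q ^ t).map (algebraMap (𝓞 F) (𝓞 K)) with hJ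
  have hP0 : q.map (algebraMap (𝓞 F) (𝓞 K)) ≠ ⊥ := by
    rw [Ne, Ideal.map_eq_bot_iff_of_injective (FaithfulSMul.algebraMap_injective _ _)]
    exact hq0
  have hPm := hinert.isMaximal hP0
  obtain ⟨⟨x, hx⟩, -, -⟩ := exists_residue_galois hσ q hq0 hinert
  obtain ⟨w, hw⟩ := exists_prod_sub_mem_map_pow hσ q hq0 hinert huq (t - 1)
  rw [Nat.sub_add_cancel ht] at hw
  have hτn : τ ^ Module.finrank F K = 1 := by
    rw [hτ, ← map_pow, ← IsGalois.card_aut_eq_finrank F K, pow_card_eq_one', map_one]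
  have hV : IsUnit (Matrix.vandermonde fun i : Fin (Module.finrank F K) =>
      Ideal.Quotient.mk J ((τ ^ i.val) x)).det :=
    Matrix.isUnit_det_vandermonde _ fun i j hij => by
      rw [← map_sub]
      exact isUnit_mk_pow hPm t (hx i j hij)
  have hVu := (Matrix.isUnit_iff_isUnit_det _).2 hV
  obtain ⟨b, hb⟩ := exists_basis_pow (q ^ t) (pow_ne_zero t hq0) τ x hV
  -- If a conjugate of `w` lay in the inert prime, so would `w`, its norm, and finally `u`.
  have hwτ : ∀ i : ℕ, (τ ^ i) w ∉ q.map (algebraMap (𝓞 F) (𝓞 K)) := by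
    intro i hi
    have hwP : w ∈ q.map (algebraMap (𝓞 F) (𝓞 K)) := by
      have h := algEquiv_mem_map (τ ^ i)⁻¹ q hi
      rwa [← AlgEquiv.mul_apply, inv_mul_cancel] at h
    refine huq ?_
    rw [← Ideal.comap_map_eq_self_of_faithfullyFlat (B := 𝓞 K) q, Ideal.mem_comap]
    have hprod : ∏ i : Fin (Module.finrank F K), (τ ^ i.val) w ∈
        q.map (algebraMap (𝓞 F) (𝓞 K)) :=
      Ideal.mem_of_dvd _ (Finset.dvd_prod_of_mem _ (Finset.mem_univ ⟨0, Module.finrank_pos⟩))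
        (by simpa using hwP)
    have h := sub_mem hprod (Ideal.map_mono (Ideal.pow_le_self (by omega)) hw)
    rwa [sub_sub_cancel] at h
  have hW : ∀ i : ℕ, IsUnit (Ideal.Quotient.mk J (∏ l : Fin i, (τ ^ l.val) w)) := by
    intro i
    rw [map_prod, IsUnit.prod_univ_iff]
    exact fun l => isUnit_mk_pow hPm t (hwτ l)
  let φ := lift (σ := σ) (u := u) (mulEnd (q ^ t)) (twistedEnd (q ^ t) τ w)
    (fun c => by
      refine LinearMap.ext fun y => ?_
      obtain ⟨y, rfl⟩ := Ideal.Quotient.mk_surjective y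
      rw [Module.End.mul_apply, Module.End.mul_apply, mulEnd_mk, twistedEnd_mk, twistedEnd_mk,
        mulEnd_mk, map_mul τ, mul_left_comm])
    (by
      refine LinearMap.ext fun y => ?_
      obtain ⟨y, rfl⟩ := Ideal.Quotient.mk_surjective y
      rw [twistedEnd_pow_mk, hτn, map_mul, (Ideal.Quotient.eq).2 hw, ← map_mul]
      rfl)
  have hφ : ∀ a m, φ a (b m) = ((Matrix.vandermonde fun i : Fin (Module.finrank F K) =>
      Ideal.Quotient.mk J ((τ ^ i.val) x)).vecMul fun i => Ideal.Quotient.mk J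
        (coord a i * ∏ l : Fin i.val, (τ ^ l.val) w)) m := by
    intro a m
    rw [hb, lift_apply, LinearMap.sum_apply]
    refine Finset.sum_congr rfl fun i _ => ?_
    rw [Module.End.mul_apply, twistedEnd_pow_mk, mulEnd_mk, map_pow (τ ^ i.val), ← mul_assoc,
      map_mul (Ideal.Quotient.mk _), map_pow (Ideal.Quotient.mk _)]
    rfl
  let e := (LinearMap.toMatrixAlgEquiv b).restrictScalars (𝓞 F)
  refine ⟨e.toAlgHom.comp φ, e.surjective.comp (g := e) (f := φ) fun g => ?_, fun a ha j => ?_⟩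
  · obtain ⟨v, hv⟩ : ∃ v, (Matrix.vandermonde fun i : Fin (Module.finrank F K) =>
        Ideal.Quotient.mk J ((τ ^ i.val) x)).vecMul v = fun m => g (b m) :=
      ⟨Matrix.vecMul (fun m => g (b m)) _⁻¹, by
        rw [Matrix.vecMul_vecMul, Matrix.nonsing_inv_mul _ hV, Matrix.vecMul_one]⟩
    -- Solve the Vandermonde system for `v`, then divide by the partial norm of `w` that `z ^ i`
    -- contributes.
    choose c hc using fun i => Ideal.Quotient.mk_surjective (v i * (↑(hW i.val).unit⁻¹ : 𝓞 K ⧸ J))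
    refine ⟨ofCoord c, b.ext fun m => ?_⟩
    rw [hφ, ← congrFun hv m]
    congr 2
    ext i
    rw [coord_ofCoord, map_mul, hc, mul_assoc, (hW i.val).val_inv_mul, mul_one]
  · have h0 : φ a = 0 := e.injective (ha.trans (map_zero e).symm)
    have h1 : (fun i : Fin (Module.finrank F K) => Ideal.Quotient.mk J
        (coord a i * ∏ l : Fin i.val, (τ ^ l.val) w)) = 0 := by
      refine Matrix.vecMul_injective_of_isUnit hVu (funext fun m => ?_)
      refine (hφ a m).symm.trans ?_
      simp [h0]
    have h2 := congrFun h1 j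
    rw [Pi.zero_apply, map_mul, (hW j).mul_left_eq_zero] at h2
    exact Ideal.Quotient.eq_zero_iff_mem.1 h2

/-- The coordinatewise condition already defines a two-sided ideal, because `I 𝓞 K` is stable under
the Galois group. -/
theorem mem_extend_iff {I : Ideal (𝓞 F)} {x : naturalOrder σ u} :
    x ∈ extend σ u I ↔ ∀ j, coord x j ∈ I.map (algebraMap (𝓞 F) (𝓞 K)) := by
  refine ⟨fun hx => ?_, mem_extend_of_coord_mem⟩
  let J : TwoSidedIdeal (naturalOrder σ u) := TwoSidedIdeal.mk'
    {x | ∀ j, coord x j ∈ I.map (algebraMap (𝓞 F) (𝓞 K))}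
    (fun j => by
      have h := coord_algebraMap (σ := σ) (u := u) 0 j
      rw [map_zero, map_zero, ite_self] at h
      rw [h]
      exact zero_mem _)
    (fun {x y} hx hy j => by
      rw [coord_add]
      exact add_mem (hx j) (hy j))
    (fun {x} hx j => by
      have h := coord_ofCoord_mul (-1) x j
      have h1 : (ofCoord (fun j => if j.val = 0 then -1 else 0) : naturalOrder σ u) = -1 := by
        refine coord_injective (funext fun k => ?_)
        have h2 := coord_algebraMap (σ := σ) (u := u) (-1) k
        rw [map_neg, map_neg, map_one, map_one] at h2
        rw [h2, coord_ofCoord]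
      rw [h1, neg_one_mul] at h
      rw [h]
      exact Ideal.mul_mem_left _ _ (hx j))
    (fun {x y} hy j => by
      rw [coord_mul]
      exact sum_mem fun i _ => Ideal.mul_mem_left _ _ (Ideal.mul_mem_left _ _
        (algEquiv_mem_map _ I (hy _))))
    (fun {x y} hx j => by
      rw [coord_mul]
      exact sum_mem fun i _ => Ideal.mul_mem_left _ _ (Ideal.mul_mem_right _ _ (hx _)))
  have hle : extend σ u I ≤ J := by
    refine TwoSidedIdeal.span_le.2 ?_
    rintro _ ⟨r, hr, rfl⟩
    refine (TwoSidedIdeal.mem_mk' ..).2 fun j => ?_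
    rw [coord_algebraMap]
    split_ifs
    · exact Ideal.mem_map_of_mem _ hr
    · exact zero_mem _
  exact (TwoSidedIdeal.mem_mk' ..).1 (hle hx)

theorem nonempty_quotient_equiv_matrix
    (hσ : ∀ τ : K ≃ₐ[F] K, τ ∈ Subgroup.zpowers σ) (q : Ideal (𝓞 F)) (hq : q.IsPrime) (hq0 : q ≠ ⊥)
    (hinert : (q.map (algebraMap (𝓞 F) (𝓞 K))).IsPrime) (huq : u ∉ q) (t : ℕ) (ht : 1 ≤ t) :
    Nonempty ((extend σ u (q ^ t)).ringCon.Quotient ≃ₐ[𝓞 F]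
      Matrix (Fin (Module.finrank F K)) (Fin (Module.finrank F K)) (𝓞 F ⧸ q ^ t)) := by
  obtain ⟨f, hf, hker⟩ := exists_surjective_matrix hσ q hq hq0 hinert huq t ht
  refine ⟨TwoSidedIdeal.quotientEquivOfMemIff _ f hf fun x =>
    ⟨fun hx => ?_, fun hx => mem_extend_of_coord_mem (hker x hx)⟩⟩
  have hle : extend σ u (q ^ t) ≤ TwoSidedIdeal.ker f := by
    refine TwoSidedIdeal.span_le.2 ?_
    rintro _ ⟨r, hr, rfl⟩
    rw [SetLike.mem_coe, TwoSidedIdeal.mem_ker, AlgHom.commutes,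
      IsScalarTower.algebraMap_apply (𝓞 F) (𝓞 F ⧸ q ^ t), Ideal.Quotient.algebraMap_eq,
      Ideal.Quotient.eq_zero_iff_mem.2 hr, map_zero]
  exact (TwoSidedIdeal.mem_ker f).1 (hle hx)

theorem extend_ne_top {I : Ideal (𝓞 F)} (hI : I ≠ ⊤) : extend σ u I ≠ ⊤ := by
  intro h
  have h1 : (1 : naturalOrder σ u) ∈ extend σ u I := h ▸ TwoSidedIdeal.mem_top _
  have h2 := mem_extend_iff.1 h1 ⟨0, Module.finrank_pos⟩
  rw [← map_one (algebraMap (𝓞 F) (naturalOrder σ u)), coord_algebraMap, if_pos rfl,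
    ← Ideal.mem_comap, Ideal.comap_map_eq_self_of_faithfullyFlat] at h2
  exact hI ((Ideal.eq_top_iff_one I).2 h2)

theorem extend_le_and_ne_top_iff
    (hσ : ∀ τ : K ≃ₐ[F] K, τ ∈ Subgroup.zpowers σ) (q : Ideal (𝓞 F)) (hq : q.IsPrime) (hq0 : q ≠ ⊥)
    (hinert : (q.map (algebraMap (𝓞 F) (𝓞 K))).IsPrime) (huq : u ∉ q) (s : ℕ) (hs : 1 ≤ s)
    (J : TwoSidedIdeal (naturalOrder σ u)) :
    (extend σ u (q ^ s) ≤ J ∧ J ≠ ⊤) ↔ ∃ t : ℕ, 1 ≤ t ∧ t ≤ s ∧ J = extend σ u (q ^ t) := by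
  constructor
  · rintro ⟨hle, hJ⟩
    obtain ⟨f, hf, hker⟩ := exists_surjective_matrix hσ q hq hq0 hinert huq s hs
    have : Nonempty (Fin (Module.finrank F K)) := ⟨⟨0, Module.finrank_pos⟩⟩
    let I : Ideal (𝓞 F) := TwoSidedIdeal.asIdeal (J.comap (algebraMap (𝓞 F) (naturalOrder σ u)))
    have hI : ∀ r, r ∈ I ↔ algebraMap (𝓞 F) (naturalOrder σ u) r ∈ J := fun r => by
      rw [TwoSidedIdeal.mem_asIdeal, TwoSidedIdeal.mem_comap]
    have hJI : J = extend σ u I := TwoSidedIdeal.eq_span_comap_of_surjective_matrix (q ^ s) f hf J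
      (fun x hx => mem_extend_of_coord_mem (hker x hx)) hle I hI
    have hqI : I ∣ q ^ s := Ideal.dvd_iff_le.2 fun r hr =>
      (hI r).2 (hle (TwoSidedIdeal.subset_span ⟨r, hr, rfl⟩))
    -- In a Dedekind domain the divisors of `q ^ s` are powers of `q`; exponent `0` would put `1` in
    -- `J`.
    obtain ⟨t, hts, ht⟩ := (dvd_prime_pow (Ideal.prime_of_isPrime hq0 hq) s).1 hqI
    rw [associated_iff_eq] at ht
    refine ⟨t, Nat.one_le_iff_ne_zero.2 ?_, hts, ht ▸ hJI⟩
    rintro rfl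
    refine hJ (J.one_mem_iff.1 ?_)
    rw [← map_one (algebraMap (𝓞 F) (naturalOrder σ u)), ← hI, ht, pow_zero, Ideal.one_eq_top]
    trivial
  · rintro ⟨t, ht, hts, rfl⟩
    refine ⟨TwoSidedIdeal.span_mono (Set.image_mono (Ideal.pow_le_pow_right hts)),
      extend_ne_top fun h => hq.ne_top ?_⟩
    exact top_le_iff.1 (h.ge.trans (Ideal.pow_le_self (by omega)))

end naturalOrder

theorem mainTheorem4 {F K : Type*} [Field F] [NumberField F] [Field K] [NumberField K]
    [Algebra F K] [IsGalois F K]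
    (σ : K ≃ₐ[F] K) (hσ : ∀ τ : K ≃ₐ[F] K, τ ∈ Subgroup.zpowers σ)
    (u : 𝓞 F)
    (q : Ideal (𝓞 F)) (hq : q.IsPrime) (hq0 : q ≠ ⊥)
    (hinert : (q.map (algebraMap (𝓞 F) (𝓞 K))).IsPrime)
    (huq : u ∉ q) (s : ℕ) (hs : 1 < s) :
    Nonempty ((naturalOrder.extend σ u (q ^ s)).ringCon.Quotient ≃ₐ[𝓞 F]
      Matrix (Fin (Module.finrank F K)) (Fin (Module.finrank F K)) (𝓞 F ⧸ q ^ s)) ∧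
    (∀ J : TwoSidedIdeal (naturalOrder σ u),
      (naturalOrder.extend σ u (q ^ s) ≤ J ∧ J ≠ ⊤) ↔
        ∃ t : ℕ, 1 ≤ t ∧ t ≤ s ∧ J = naturalOrder.extend σ u (q ^ t)) ∧
    (∀ t : ℕ, 1 ≤ t → t ≤ s →
      (∀ x : naturalOrder σ u, x ∈ naturalOrder.extend σ u (q ^ t) ↔
        ∀ j, ∃ c ∈ (q ^ t).map (algebraMap (𝓞 F) (𝓞 K)),
          (x : CyclicAlgebra σ (u : F)).coeff j = (c : K)) ∧
      Nonempty ((naturalOrder.extend σ u (q ^ t)).ringCon.Quotient ≃ₐ[𝓞 F]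
        Matrix (Fin (Module.finrank F K)) (Fin (Module.finrank F K)) (𝓞 F ⧸ q ^ t))) := by
  refine ⟨naturalOrder.nonempty_quotient_equiv_matrix hσ q hq hq0 hinert huq s hs.le,
    naturalOrder.extend_le_and_ne_top_iff hσ q hq hq0 hinert huq s hs.le, fun t ht _ =>
    ⟨fun x => ?_, naturalOrder.nonempty_quotient_equiv_matrix hσ q hq hq0 hinert huq t ht⟩⟩
  rw [naturalOrder.mem_extend_iff]
  refine forall_congr' fun j => ⟨fun h => ⟨_, h, (naturalOrder.coe_coord x j).symm⟩, ?_⟩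
  rintro ⟨c, hc, hxc⟩
  rwa [NumberField.RingOfIntegers.ext ((naturalOrder.coe_coord x j).trans hxc)]
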